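/- Let $n,N$ be non-negative integers and let $h\in C^4([-1,1])$ be real-valued with $h^{(4)}\ge 0$ on $[-1,1]$. Suppose that either $\tau=3$ and $2n\le N<\tfrac{n(n+3)}2$, or $\tau=4$ and $\tfrac{n(n+3)}2\le N<n^2+n$. A spherical $\tau$-design is a finite set $C\subset\mathbb S^{n-1}\subset\mathbb R^n$ such that $\frac1{\mu(\mathbb S^{n-1})}\int_{\mathbb S^{n-1}}f\,d\mu=\frac1{|C|}\sum_{x\in C}f(x)$ for all real polynomials $f$ in $n$ variables of total degree at most $\tau$, where $\mu$ is surface measure. Let $$\mathcal U(n,N,\tau;h)=\sup\Big\{\sum_{x,y\in C,\;x\ne y}h(\langle x,y\rangle)\;:\;C\subset\mathbb S^{n-1}\text{ a spherical }\tau\text{-design},\ |C|=N\Big\}$$ (sum over ordered pairs; $\sup\emptyset=-\infty$). Let $\ell,u$ with $-1\le\ell$, $u\le1$ be bounds for the inner products of these designs, that is, $\ell\le\langle x,y\rangle\le u$ for all distinct points $x,y$ of every spherical $\tau$-design of $N$ points on $\mathbb S^{n-1}$. Put $$A=N(\ell+u)+n(1-\ell)(1-u),\qquad B=n(1-\ell)(1-u)-N(1+\ell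 u n),\qquad a_0=\frac AB \text{ if } B\neq 0,$$ $$\begin{aligned}F(a)=N(N-1)h(a)&+\frac{N\,(h(\ell)-h(a))\left[uN(1+na^2)+2Na+n(1-u)(1-a)^2\right]}{n(u-\ell)(\ell-a)^2}\\&-\frac{N\,(h(u)-h(a))\left[\ell N(1+na^2)+2Na+n(1-\ell)(1-a)^2\right]}{n(u-\ell)(u-a)^2}.\end{aligned}$$ 1. If $B\ne0$, then $\mathcal U(n,N,\tau;h)\le F(a_0)$. If $B=0$, then $\mathcal U(n,N,\tau;h)\le F(a)$ for every $a\in(\ell,u)$. (If there are no such designs, $\mathcal U=-\infty$ and these inequalities are read as trivially true.) 2. Suppose that at least one such design exists. Then $\ell<u$ and $B\ge0$. If moreover $B\neq0$, then $\ell<a_0<u$ and $F(a_0)=N(g_0N-g(1))$ for a polynomial $g$ of degree at most $3$ with $$g(\ell)=h(\ell),\quad g(a)=h(a),\quad g'(a)=h'(a),\quad g(u)=h(u)\qquad(*)$$ for $a=a_0$; and the choice $a=a_0$ is optimal: $F(a_0)\le N(g_0N-g(1))$ for every $a\in(\ell,u)$ and every polynomial $g$ of degree at most $3$ satisfying $(*)$.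 Here $g_0$ is the constant coefficient in the expansion $g=\sum_{i=0}^3 g_iP_i^{(n)}$ in Gegenbauer polynomials, given by $P_0^{(n)}=1$, $P_1^{(n)}=t$, $(i+n-2)P_{i+1}^{(n)}=(2i+n-2)\,t\,P_i^{(n)}-i\,P_{i-1}^{(n)}$ for $i\ge1$. 3. If $\tau=3$, then $\ell=-1$ and $u=u(n,N,3)$, the supremum of $\langle x,y\rangle$ over distinct points $x,y$ of spherical $3$-designs of $N$ points on $\mathbb S^{n-1}$ (with the convention $\sup\emptyset=0$), are admissible bounds. 4. If $\tau=4$, then $$\ell=1-\frac2n\left(1+\sqrt{\frac{(n-1)(N-2)}{n+2}}\right),\qquad u=\frac{2\left(3+\sqrt{(n-1)[(n+2)N-3(n+3)]}\right)}{n(n+2)}-1$$ are admissible bounds, for them $B>0$, and therefore $\mathcal U(n,N,4;h)\le F(a_0)$ with these $\ell,u$. -/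

import Mathlib

open MeasureTheory Polynomial

noncomputable section

/-- A finite subset `C` of the unit sphere of `ℝⁿ` is a spherical `τ`-design if, for every real
polynomial in `n` variables of total degree at most `τ`, the mean over the sphere with respect to
the surface measure equals the mean over `C`. -/
structure IsSphericalDesign (n τ : ℕ) (C : Finset (EuclideanSpace ℝ (Fin n))) : Prop where
  norm_eq_one : ∀ x ∈ C, ‖x‖ = 1
  mean_eq : ∀ p : MvPolynomial (Fin n) ℝ, p.totalDegree ≤ τ →
    (⨍ x : Metric.sphere (0 : EuclideanSpace ℝ (Fin n)) 1,
        MvPolynomial.eval (fun i => (x : EuclideanSpace ℝ (Fin n)) i) p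
        ∂((volume : Measure (EuclideanSpace ℝ (Fin n))).toSphere))
      = (1 / (C.card : ℝ)) * ∑ x ∈ C, MvPolynomial.eval (fun i => x i) p

/-- The set of all spherical `τ`-designs with `N` points on the unit sphere of `ℝⁿ`. -/
def sphericalDesigns (n N τ : ℕ) : Set (Finset (EuclideanSpace ℝ (Fin n))) :=
  {C | IsSphericalDesign n τ C ∧ C.card = N}

open Classical in
/-- The `h`-energy of `C`: the sum of `h ⟨x, y⟩` over all ordered pairs of distinct points. -/
def sphericalEnergy {n : ℕ} (h : ℝ → ℝ) (C : Finset (EuclideanSpace ℝ (Fin n))) : ℝ :=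
  ∑ p ∈ C.offDiag, h (inner ℝ p.1 p.2)

/-- `𝒰(n, N, τ; h)`: the supremum of the `h`-energy over all spherical `τ`-designs of `N` points on
the unit sphere of `ℝⁿ`, taken in the extended reals (it is `⊥` if there is no such design). -/
def maxDesignEnergy (n N τ : ℕ) (h : ℝ → ℝ) : EReal :=
  ⨆ C ∈ sphericalDesigns n N τ, ((sphericalEnergy h C : ℝ) : EReal)

/-- `ℓ` and `u` are a lower and an upper bound, within `[-1, 1]`, for the inner products of distinct
points of any spherical `τ`-design of `N` points on the unit sphere of `ℝⁿ`. -/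
structure IsInnerProductBounds (n N τ : ℕ) (ℓ u : ℝ) : Prop where
  neg_one_le : -1 ≤ ℓ
  le_one : u ≤ 1
  bounds : ∀ C ∈ sphericalDesigns n N τ, ∀ x ∈ C, ∀ y ∈ C, x ≠ y →
    ℓ ≤ inner ℝ x y ∧ inner ℝ x y ≤ u

/-- `u(n, N, τ)`: the largest inner product of distinct points that occurs, as a supremum, in the
spherical `τ`-designs of `N` points on the unit sphere of `ℝⁿ`. -/
def maxInnerProduct (n N τ : ℕ) : ℝ :=
  sSup {t : ℝ | ∃ C ∈ sphericalDesigns n N τ, ∃ x ∈ C, ∃ y ∈ C, x ≠ y ∧ inner ℝ x y = t}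

/-- The explicit lower bound for the inner products of a spherical `4`-design. -/
def lowerFour (n N : ℕ) : ℝ :=
  1 - 2 / (n : ℝ) * (1 + √(((n : ℝ) - 1) * ((N : ℝ) - 2) / ((n : ℝ) + 2)))

/-- The explicit upper bound for the inner products of a spherical `4`-design. -/
def upperFour (n N : ℕ) : ℝ :=
  2 * (3 + √(((n : ℝ) - 1) * (((n : ℝ) + 2) * (N : ℝ) - 3 * ((n : ℝ) + 3)))) /
    ((n : ℝ) * ((n : ℝ) + 2)) - 1

/-- The numerator of the touching point `a₀`. -/
def touchNum (n N : ℕ) (ℓ u : ℝ) : ℝ :=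
  (N : ℝ) * (ℓ + u) + (n : ℝ) * (1 - ℓ) * (1 - u)

/-- The denominator of the touching point `a₀`. -/
def touchDen (n N : ℕ) (ℓ u : ℝ) : ℝ :=
  (n : ℝ) * (1 - ℓ) * (1 - u) - (N : ℝ) * (1 + ℓ * u * (n : ℝ))

/-- The touching point `a₀`. -/
def touchPoint (n N : ℕ) (ℓ u : ℝ) : ℝ :=
  touchNum n N ℓ u / touchDen n N ℓ u

/-- The explicit upper bound for the energy, as a function of the touching point `a`. -/
def cubicBound (n N : ℕ) (h : ℝ → ℝ) (ℓ u a : ℝ) : ℝ :=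
  (N : ℝ) * ((N : ℝ) - 1) * h a
    + (N : ℝ) * (h ℓ - h a)
        * (u * N * (1 + n * a ^ 2) + 2 * N * a + n * (1 - u) * (1 - a) ^ 2)
        / (n * (u - ℓ) * (ℓ - a) ^ 2)
    - (N : ℝ) * (h u - h a)
        * (ℓ * N * (1 + n * a ^ 2) + 2 * N * a + n * (1 - ℓ) * (1 - a) ^ 2)
        / (n * (u - ℓ) * (u - a) ^ 2)

/-- The Gegenbauer polynomials for dimension `n`, normalized to be `1` at `1`: `P₀ = 1`, `P₁ = t`
and `(i + n - 2) Pᵢ₊₁ = (2 i + n - 2) t Pᵢ - i Pᵢ₋₁` for `i ≥ 1`. -/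
def gegenbauer (n : ℕ) : ℕ → ℝ[X]
  | 0 => 1
  | 1 => X
  | i + 2 => C (1 / ((i : ℝ) + 1 + n - 2)) *
      (C (2 * ((i : ℝ) + 1) + n - 2) * X * gegenbauer n (i + 1)
        - C ((i : ℝ) + 1) * gegenbauer n i)

/-- The polynomial of degree at most three with Gegenbauer coefficients `g 0, …, g 3`. -/
def gegenbauerCubic (n : ℕ) (g : Fin 4 → ℝ) : ℝ[X] :=
  ∑ i : Fin 4, C (g i) * gegenbauer n i

/-- `p` agrees with `h` at `ℓ`, at `u`, and to first order at `a`. -/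
structure Interpolates (h : ℝ → ℝ) (ℓ a u : ℝ) (p : ℝ[X]) : Prop where
  eval_lower : p.eval ℓ = h ℓ
  eval_touch : p.eval a = h a
  deriv_touch : p.derivative.eval a = derivWithin h (Set.Icc (-1) 1) a
  eval_upper : p.eval u = h u

/-- The linear programming value `N (g₀ N - p(1))` of the cubic `p` with Gegenbauer coefficients
`g`. -/
def lpValue (n N : ℕ) (g : Fin 4 → ℝ) : ℝ :=
  (N : ℝ) * (g 0 * N - (gegenbauerCubic n g).eval 1)

end

/-! Write L(g) = N(g₀N − g(1)). A design of strength at least 3 has the sphere's moments of orders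
1, 2, 3, so for a cubic g the sum of g(⟨x,y⟩) over ordered pairs of distinct points is exactly L(g)
(`IsSphericalDesign.sum_erase_gegenbauerCubic`). Every cubic g ≥ h on [ℓ,u] therefore bounds the
energy by L(g). The Hermite interpolant at ℓ, a, a, u is such a cubic, since h − g is h⁗(ξ)/24 times
(t−ℓ)(t−a)²(t−u) ≤ 0 (`le_eval_of_interpolates`).

For this interpolant L(g) = F(a) + h′(a)·L(w)/((a−ℓ)(a−u)), where w = (t−ℓ)(t−a)(t−u) and L(w) =
(N/n)(aB − A). When aB = A the derivative term drops out: L is then a quadrature on the nodes ℓ, a,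
u, exact on cubics (`lpValue_eq_cubicBound`). For B > 0 its weight at a₀ is positive, and an
interpolant touching at another point still majorizes h at a₀; this gives optimality. That a₀ lies
in (ℓ,u) holds because it is a weighted mean of inner products (`touchPoint_spec`).

For 4-designs the explicit ℓ and u come from summing the square of a quadratic in ⟨z, x∓y⟩ over the
design and keeping only the terms z = x and z = y. -/

noncomputable section

/-! ### Moments of linear forms on the sphere and on designs -/

/-- The homeomorphism of the unit sphere induced by a linear isometry. -/
def LinearIsometryEquiv.unitSphereHomeomorph {E : Type*} [NormedAddCommGroup E] [NormedSpace ℝ E]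
    (e : E ≃ₗᵢ[ℝ] E) : Metric.sphere (0 : E) 1 ≃ₜ Metric.sphere (0 : E) 1 :=
  e.toHomeomorph.subtype (by simp)

open scoped Pointwise in
-- `toSphere` measures a set through the volume of the cone over it, and a linear isometry maps
-- cones to cones and preserves volume.
theorem LinearIsometryEquiv.measurePreserving_unitSphereHomeomorph {E : Type*}
    [NormedAddCommGroup E] [InnerProductSpace ℝ E] [FiniteDimensional ℝ E] [MeasurableSpace E]
    [BorelSpace E] (e : E ≃ₗᵢ[ℝ] E) :
    MeasurePreserving e.unitSphereHomeomorph (volume : Measure E).toSphere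
      (volume : Measure E).toSphere := by
  refine ⟨e.unitSphereHomeomorph.continuous.measurable, ?_⟩
  ext s hs
  have hm := e.unitSphereHomeomorph.continuous.measurable hs
  rw [Measure.map_apply e.unitSphereHomeomorph.continuous.measurable hs,
    Measure.toSphere_apply' _ hm, Measure.toSphere_apply' _ hs]
  congr 1
  refine Eq.trans ?_
    (e.measurePreserving.measure_preimage_emb e.toHomeomorph.measurableEmbedding _)
  congr 1
  ext x
  simp only [Set.mem_smul, Set.mem_image, Set.mem_preimage, Subtype.exists, exists_and_right,
    exists_eq_right, mem_sphere_zero_iff_norm]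
  constructor
  · rintro ⟨r, hr, y, ⟨hy, hys⟩, rfl⟩
    exact ⟨r, hr, e y, ⟨by simpa using hy, hys⟩, by simp⟩
  · rintro ⟨r, hr, y, ⟨hy, hys⟩, h⟩
    refine ⟨r, hr, e.symm y, ⟨by simpa using hy, ?_⟩, ?_⟩
    · convert hys
      exact e.apply_symm_apply y
    · apply e.injective
      simp [← h]

/-- The mean over the unit sphere of the `k`-th power of the inner product with `v`. -/
def sphereMoment (n k : ℕ) (v : EuclideanSpace ℝ (Fin n)) : ℝ :=
  ⨍ x : Metric.sphere (0 : EuclideanSpace ℝ (Fin n)) 1,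
    (inner ℝ (x : EuclideanSpace ℝ (Fin n)) v) ^ k
      ∂((volume : Measure (EuclideanSpace ℝ (Fin n))).toSphere)

theorem sphereMoment_map (n k : ℕ) (v : EuclideanSpace ℝ (Fin n))
    (e : EuclideanSpace ℝ (Fin n) ≃ₗᵢ[ℝ] EuclideanSpace ℝ (Fin n)) :
    sphereMoment n k (e v) = sphereMoment n k v := by
  unfold sphereMoment
  rw [average_eq, average_eq, ← e.measurePreserving_unitSphereHomeomorph.integral_comp
    e.unitSphereHomeomorph.measurableEmbedding]
  congr 2
  ext x
  exact congrArg (· ^ k) (e.inner_map_map x v)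

theorem sphereMoment_smul (n k : ℕ) (r : ℝ) (v : EuclideanSpace ℝ (Fin n)) :
    sphereMoment n k (r • v) = r ^ k * sphereMoment n k v := by
  simp only [sphereMoment, inner_smul_right, mul_pow, average_eq, smul_eq_mul,
    integral_const_mul]
  ring

theorem sphereMoment_of_odd (n : ℕ) {k : ℕ} (hk : Odd k) (v : EuclideanSpace ℝ (Fin n)) :
    sphereMoment n k v = 0 := by
  have h1 := sphereMoment_map n k v (LinearIsometryEquiv.neg ℝ)
  have h2 := sphereMoment_smul n k (-1) v
  rw [hk.neg_one_pow, neg_one_smul] at h2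
  rw [LinearIsometryEquiv.coe_neg] at h1
  linarith

/-- Two vectors of equal norm are exchanged by a reflection. -/
theorem sphereMoment_eq_of_norm_eq (n k : ℕ) {v w : EuclideanSpace ℝ (Fin n)} (h : ‖v‖ = ‖w‖) :
    sphereMoment n k v = sphereMoment n k w := by
  rw [← Submodule.reflection_sub h, sphereMoment_map]

theorem sphereMoment_eq_norm_pow_mul (n k : ℕ) (v : EuclideanSpace ℝ (Fin n))
    {w : EuclideanSpace ℝ (Fin n)} (hw : ‖w‖ = 1) :
    sphereMoment n k v = ‖v‖ ^ k * sphereMoment n k w := by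
  rw [← sphereMoment_smul]
  exact sphereMoment_eq_of_norm_eq n k (by simp [norm_smul, hw])

theorem Continuous.integrable_of_compactSpace {X : Type*} [TopologicalSpace X] [CompactSpace X]
    [MeasurableSpace X] [OpensMeasurableSpace X] {μ : Measure X} [IsFiniteMeasure μ] {f : X → ℝ}
    (hf : Continuous f) : Integrable f μ :=
  hf.integrable_of_hasCompactSupport (HasCompactSupport.of_compactSpace _)

/-- The normalized surface measure of the unit sphere. -/
def sphereProb (n : ℕ) : Measure (Metric.sphere (0 : EuclideanSpace ℝ (Fin n)) 1) :=
  ((volume : Measure (EuclideanSpace ℝ (Fin n))).toSphere Set.univ)⁻¹ •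
    (volume : Measure (EuclideanSpace ℝ (Fin n))).toSphere

theorem isProbabilityMeasure_sphereProb {n : ℕ} (hn : 0 < n) :
    IsProbabilityMeasure (sphereProb n) := by
  have : Nonempty (Fin n) := ⟨⟨0, hn⟩⟩
  have : NeZero (volume : Measure (EuclideanSpace ℝ (Fin n))).toSphere :=
    ⟨Measure.toSphere_ne_zero _⟩
  unfold sphereProb
  infer_instance

theorem sphereMoment_eq_integral (n k : ℕ) (v : EuclideanSpace ℝ (Fin n)) :
    sphereMoment n k v = ∫ x, (inner ℝ (x : EuclideanSpace ℝ (Fin n)) v) ^ k ∂sphereProb n :=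
  average_eq' _ _

theorem sphereMoment_two {n : ℕ} (hn : 0 < n) (v : EuclideanSpace ℝ (Fin n)) :
    sphereMoment n 2 v = ‖v‖ ^ 2 / n := by
  have := isProbabilityMeasure_sphereProb hn
  set b := EuclideanSpace.basisFun (Fin n) ℝ
  have hb (i : Fin n) : ‖b i‖ = 1 := b.norm_eq_one i
  let i₀ : Fin n := ⟨0, hn⟩
  have hsum : ∑ i, sphereMoment n 2 (b i) = 1 := by
    simp only [sphereMoment_eq_integral]
    rw [← integral_finsetSum _ fun i _ => Continuous.integrable_of_compactSpace (by fun_prop)]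
    have (x : Metric.sphere (0 : EuclideanSpace ℝ (Fin n)) 1) :
        ∑ i, inner ℝ (x : EuclideanSpace ℝ (Fin n)) (b i) ^ 2 = 1 := by
      rw [b.sum_sq_inner_left (x : EuclideanSpace ℝ (Fin n))]; simp
    simp [this]
  have hM (i : Fin n) : sphereMoment n 2 (b i) = sphereMoment n 2 (b i₀) :=
    sphereMoment_eq_of_norm_eq n 2 (by rw [hb, hb])
  rw [Finset.sum_congr rfl fun i _ => hM i] at hsum
  rw [sphereMoment_eq_norm_pow_mul n 2 v (hb i₀)]
  have : (n : ℝ) ≠ 0 := by positivity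
  simp at hsum
  field_simp
  linear_combination ‖v‖ ^ 2 * hsum

/-- Polarization: (s+r)⁴ + (s−r)⁴ − 2s⁴ − 2r⁴ = 12s²r². With s = ⟨x,y⟩, r = ⟨x,bᵢ⟩ and a sum over
the orthonormal basis, the fourth moment c of a unit vector satisfies c(4n+8) = 12/n. -/
theorem sphereMoment_four {n : ℕ} (hn : 0 < n) (v : EuclideanSpace ℝ (Fin n)) :
    sphereMoment n 4 v = 3 * ‖v‖ ^ 4 / (n * (n + 2)) := by
  have := isProbabilityMeasure_sphereProb hn
  set b := EuclideanSpace.basisFun (Fin n) ℝ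
  have hb (i : Fin n) : ‖b i‖ = 1 := b.norm_eq_one i
  let i₀ : Fin n := ⟨0, hn⟩
  set y := b i₀
  have hy : ‖y‖ = 1 := hb i₀
  set c := sphereMoment n 4 y
  have hM (w : EuclideanSpace ℝ (Fin n)) : sphereMoment n 4 w = ‖w‖ ^ 4 * c :=
    sphereMoment_eq_norm_pow_mul n 4 w hy
  have hsum : ∑ i, (sphereMoment n 4 (y + b i) + sphereMoment n 4 (y - b i)
      - 2 * sphereMoment n 4 y - 2 * sphereMoment n 4 (b i)) = 12 * sphereMoment n 2 y := by
    have hint {f : Metric.sphere (0 : EuclideanSpace ℝ (Fin n)) 1 → ℝ} (hf : Continuous f) :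
        Integrable f (sphereProb n) := hf.integrable_of_compactSpace
    simp only [sphereMoment_eq_integral, ← integral_const_mul]
    have (i : Fin n) : (∫ x : Metric.sphere (0 : EuclideanSpace ℝ (Fin n)) 1,
          inner ℝ (x : EuclideanSpace ℝ (Fin n)) (y + b i) ^ 4 ∂sphereProb n)
        + (∫ x : Metric.sphere (0 : EuclideanSpace ℝ (Fin n)) 1,
          inner ℝ (x : EuclideanSpace ℝ (Fin n)) (y - b i) ^ 4 ∂sphereProb n)
        - (∫ x : Metric.sphere (0 : EuclideanSpace ℝ (Fin n)) 1,
          2 * inner ℝ (x : EuclideanSpace ℝ (Fin n)) y ^ 4 ∂sphereProb n)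
        - (∫ x : Metric.sphere (0 : EuclideanSpace ℝ (Fin n)) 1,
          2 * inner ℝ (x : EuclideanSpace ℝ (Fin n)) (b i) ^ 4 ∂sphereProb n)
        = ∫ x : Metric.sphere (0 : EuclideanSpace ℝ (Fin n)) 1,
          12 * inner ℝ (x : EuclideanSpace ℝ (Fin n)) y ^ 2 *
            inner ℝ (x : EuclideanSpace ℝ (Fin n)) (b i) ^ 2 ∂sphereProb n := by
      rw [← integral_add (hint (by fun_prop)) (hint (by fun_prop)),
        ← integral_sub (hint (by fun_prop)) (hint (by fun_prop)),
        ← integral_sub (hint (by fun_prop)) (hint (by fun_prop))]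
      congr 1
      ext x
      rw [inner_add_right, inner_sub_right]; ring
    rw [Finset.sum_congr rfl fun i _ => this i,
      ← integral_finsetSum _ fun i _ => hint (by fun_prop)]
    congr 1
    ext x
    have hx := b.sum_sq_inner_left (x : EuclideanSpace ℝ (Fin n))
    rw [show ‖(x : EuclideanSpace ℝ (Fin n))‖ = 1 by simp] at hx
    rw [← Finset.mul_sum, hx]; ring
  have hterm (i : Fin n) : sphereMoment n 4 (y + b i) + sphereMoment n 4 (y - b i)
      - 2 * sphereMoment n 4 y - 2 * sphereMoment n 4 (b i)
      = c * (4 + 8 * inner ℝ y (b i) ^ 2) := by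
    have h1 : ‖y + b i‖ ^ 4 = (2 + 2 * inner ℝ y (b i)) ^ 2 := by
      rw [show ‖y + b i‖ ^ 4 = (‖y + b i‖ ^ 2) ^ 2 by ring, norm_add_sq_real, hy, hb]; ring
    have h2 : ‖y - b i‖ ^ 4 = (2 - 2 * inner ℝ y (b i)) ^ 2 := by
      rw [show ‖y - b i‖ ^ 4 = (‖y - b i‖ ^ 2) ^ 2 by ring, norm_sub_sq_real, hy, hb]; ring
    rw [hM (y + b i), hM (y - b i), hM (b i), h1, h2, hb]
    ring
  simp_rw [hterm, ← Finset.mul_sum, Finset.sum_add_distrib, ← Finset.mul_sum,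
    b.sum_sq_inner_left y, sphereMoment_two hn, hy] at hsum
  simp at hsum
  have : (0 : ℝ) < n := by positivity
  rw [hM v]
  field_simp at hsum ⊢
  linear_combination ‖v‖ ^ 4 / 4 * hsum

/-- The power sums of the inner products with `v` over a design are those of the sphere. -/
theorem IsSphericalDesign.sum_inner_pow {n τ : ℕ} {C : Finset (EuclideanSpace ℝ (Fin n))}
    (hC : IsSphericalDesign n τ C) (v : EuclideanSpace ℝ (Fin n)) {k : ℕ} (hk : k ≤ τ) :
    ∑ x ∈ C, (inner ℝ x v) ^ k = C.card * sphereMoment n k v := by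
  rcases C.eq_empty_or_nonempty with rfl | hne
  · simp
  set p : MvPolynomial (Fin n) ℝ :=
    (∑ i, MvPolynomial.C (v i) * MvPolynomial.X i) ^ k with hp
  have hdeg : p.totalDegree ≤ τ := by
    refine (MvPolynomial.totalDegree_pow _ _).trans (le_trans ?_ hk)
    refine (Nat.mul_le_mul_left k (m := 1) ?_).trans (by simp)
    refine MvPolynomial.totalDegree_finsetSum_le fun i _ => ?_
    refine (MvPolynomial.totalDegree_mul _ _).trans ?_
    simp
  have heval (x : EuclideanSpace ℝ (Fin n)) :
      MvPolynomial.eval (fun i => x i) p = (inner ℝ x v) ^ k := by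
    simp [hp, PiLp.inner_apply]
  have := hC.mean_eq p hdeg
  simp_rw [heval] at this
  have hcard : (C.card : ℝ) ≠ 0 := by simpa using hne.ne_empty
  rw [sphereMoment, this]
  field_simp

/-! ### Cubics in the Gegenbauer basis and Hermite interpolation -/

theorem gegenbauerCubic_eq {n : ℕ} (hn : 2 ≤ n) (g : Fin 4 → ℝ) :
    gegenbauerCubic n g = C (g 0 - g 2 / (n - 1)) + C (g 1 - 3 * g 3 / (n - 1)) * X
      + C (n * g 2 / (n - 1)) * X ^ 2 + C ((n + 2) * g 3 / (n - 1)) * X ^ 3 := by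
  have h1 : (n : ℝ) - 1 ≠ 0 := by
    have : (2 : ℝ) ≤ n := by exact_mod_cast hn
    linarith
  have h0 : (n : ℝ) ≠ 0 := by positivity
  apply Polynomial.funext
  intro x
  simp only [gegenbauerCubic, Fin.sum_univ_four, gegenbauer, Nat.cast_zero,
    Nat.cast_one, eval_add, eval_mul, eval_sub, eval_C, eval_X, eval_one, eval_pow]
  rw [show (0 : ℝ) + 1 + n - 2 = n - 1 by ring, show (1 : ℝ) + 1 + n - 2 = n by ring]
  field_simp
  ring

theorem exists_gegenbauerCubic_eq {n : ℕ} (hn : 2 ≤ n) {p : ℝ[X]} (hp : p.natDegree ≤ 3) :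
    ∃ g : Fin 4 → ℝ, gegenbauerCubic n g = p := by
  have h1 : (n : ℝ) - 1 ≠ 0 := by
    have : (2 : ℝ) ≤ n := by exact_mod_cast hn
    linarith
  have h0 : (n : ℝ) ≠ 0 := by positivity
  refine ⟨![p.coeff 0 + p.coeff 2 / n, p.coeff 1 + 3 * p.coeff 3 / (n + 2),
    p.coeff 2 * (n - 1) / n, p.coeff 3 * (n - 1) / (n + 2)], ?_⟩
  rw [gegenbauerCubic_eq hn]
  conv_rhs => rw [p.as_sum_range_C_mul_X_pow' (show p.natDegree < 4 by omega)]
  simp only [Finset.sum_range_succ, Finset.sum_range_zero, Matrix.cons_val]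
  have h2 : (n : ℝ) + 2 ≠ 0 := by positivity
  congr 1
  · congr 1
    · congr 1
      · simp only [pow_zero, mul_one, zero_add]
        congr 1; field_simp; ring
      · rw [pow_one]
        congr 2; field_simp; ring
    · congr 2; field_simp
  · congr 2; field_simp

theorem natDegree_gegenbauerCubic_le {n : ℕ} (hn : 2 ≤ n) (g : Fin 4 → ℝ) :
    (gegenbauerCubic n g).natDegree ≤ 3 := by
  rw [gegenbauerCubic_eq hn]
  compute_degree

/-- Newton's form on the nodes ℓ, a, a, u; `d₁`, `d₂`, `d₃` are the successive divided differences.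
-/
theorem exists_interpolates {n : ℕ} (hn : 2 ≤ n) (h : ℝ → ℝ) {ℓ a u : ℝ} (hℓ : ℓ < a)
    (hu : a < u) : ∃ g : Fin 4 → ℝ, Interpolates h ℓ a u (gegenbauerCubic n g) := by
  have h1 : a - ℓ ≠ 0 := by linarith
  have h2 : u - ℓ ≠ 0 := by linarith
  have h3 : u - a ≠ 0 := by linarith
  set d := derivWithin h (Set.Icc (-1) 1) a with hd
  set d₁ := (h a - h ℓ) / (a - ℓ) with hd₁
  set d₂ := (d - d₁) / (a - ℓ) with hd₂
  set d₃ := (h u - h ℓ - d₁ * (u - ℓ) - d₂ * (u - ℓ) * (u - a)) / ((u - ℓ) * (u - a) ^ 2)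
    with hd₃
  obtain ⟨g, hg⟩ := exists_gegenbauerCubic_eq hn
    (p := C (h ℓ) + C d₁ * (X - C ℓ) + C d₂ * ((X - C ℓ) * (X - C a))
      + C d₃ * ((X - C ℓ) * (X - C a) ^ 2)) (by compute_degree)
  refine ⟨g, ?_, ?_, ?_, ?_⟩
  · rw [hg]; simp
  · rw [hg]; simp [hd₁]; field_simp; ring
  · rw [hg]
    simp only [derivative_add, derivative_mul, derivative_pow, derivative_sub, derivative_X,
      derivative_C, eval_add, eval_mul, eval_sub, eval_pow, eval_C, eval_X, eval_zero, eval_one]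
    rw [← hd]
    simp [hd₂]; field_simp; ring
  · rw [hg]; simp [hd₃]; field_simp; ring

/-- The error of cubic Hermite interpolation at the nodes `ℓ, a, a, u` has the sign opposite to
that of the fourth derivative. -/
theorem le_eval_of_interpolates {h : ℝ → ℝ} (hC4 : ContDiffOn ℝ 4 h (Set.Icc (-1) 1))
    (h4 : ∀ t ∈ Set.Icc (-1 : ℝ) 1, 0 ≤ iteratedDerivWithin 4 h (Set.Icc (-1) 1) t)
    {ℓ a u : ℝ} (hℓ1 : -1 ≤ ℓ) (hu1 : u ≤ 1) (hℓ : ℓ < a) (hu : a < u) {p : ℝ[X]}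
    (hp : p.natDegree ≤ 3) (hint : Interpolates h ℓ a u p) {t : ℝ} (ht : t ∈ Set.Icc ℓ u) :
    h t ≤ p.eval t := by
  by_contra! hlt
  have htℓ : ℓ < t := lt_of_le_of_ne ht.1 (by rintro rfl; exact hlt.ne hint.eval_lower)
  have htu : t < u := lt_of_le_of_ne ht.2 (by rintro rfl; exact hlt.ne hint.eval_upper)
  have hta : t ≠ a := by rintro rfl; exact hlt.ne hint.eval_touch
  have hs : UniqueDiffOn ℝ (Set.Icc (-1 : ℝ) 1) := uniqueDiffOn_Icc (by norm_num)
  set w : ℝ[X] := (X - C ℓ) * (X - C a) ^ 2 * (X - C u) with hw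
  have hwt : w.eval t < 0 := by
    simp only [hw, eval_mul, eval_sub, eval_pow, eval_X, eval_C]
    have := sq_pos_of_ne_zero (sub_ne_zero.2 hta)
    exact mul_neg_of_pos_of_neg (mul_pos (by linarith) this) (by linarith)
  -- This `c` makes h − p − c·w vanish at t as well, while keeping the zeros ℓ, a (double) and u.
  set c := (h t - p.eval t) / w.eval t with hc
  have hc0 : c < 0 := div_neg_of_pos_of_neg (by linarith) hwt
  set q : ℝ[X] := p + C c * w with hq
  set φ : ℕ → ℝ → ℝ := fun k x =>
    iteratedDerivWithin k h (Set.Icc (-1) 1) x - (derivative^[k] q).eval x with hφ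
  have hcont (k : ℕ) (hk : k < 4) : ContinuousOn (φ k) (Set.Icc (-1) 1) :=
    (hC4.continuousOn_iteratedDerivWithin (by exact_mod_cast hk.le) hs).sub
      (Polynomial.continuous _).continuousOn
  have hderiv (k : ℕ) (hk : k < 4) (x : ℝ) (hx : x ∈ Set.Ioo (-1 : ℝ) 1) :
      HasDerivAt (φ k) (φ (k + 1) x) x := by
    refine HasDerivAt.sub ?_ ?_
    · rw [iteratedDerivWithin_succ]
      exact ((hC4.differentiableOn_iteratedDerivWithin (by exact_mod_cast hk) hs) x
        (Set.Ioo_subset_Icc_self hx)).hasDerivWithinAt.hasDerivAt (Icc_mem_nhds hx.1 hx.2)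
    · rw [Function.iterate_succ_apply']
      exact Polynomial.hasDerivAt _ _
  have rolle (k : ℕ) (hk : k < 4) (x y : ℝ) (hxy : x < y) (hx : -1 ≤ x) (hy : y ≤ 1)
      (hx0 : φ k x = 0) (hy0 : φ k y = 0) : ∃ z, x < z ∧ z < y ∧ φ (k + 1) z = 0 := by
    obtain ⟨z, hz, hz0⟩ := exists_hasDerivAt_eq_zero hxy
      ((hcont k hk).mono (Set.Icc_subset_Icc hx hy)) (hx0.trans hy0.symm)
      (fun z hz => hderiv k hk z ⟨hx.trans_lt hz.1, hz.2.trans_le hy⟩)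
    exact ⟨z, hz.1, hz.2, hz0⟩
  -- Four zeros of φ′ force a zero ξ of φ⁗ by Rolle; there h⁗(ξ) = 24c < 0, because p is cubic and w
  -- is monic of degree 4.
  have key (x₁ x₂ x₃ x₄ : ℝ) (h₀ : -1 ≤ x₁) (h₁ : x₁ < x₂) (h₂ : x₂ < x₃) (h₃ : x₃ < x₄)
      (h₅ : x₄ ≤ 1) (e₁ : φ 1 x₁ = 0) (e₂ : φ 1 x₂ = 0) (e₃ : φ 1 x₃ = 0) (e₄ : φ 1 x₄ = 0) :
      False := by
    obtain ⟨y₁, _, _, f₁⟩ := rolle 1 (by norm_num) x₁ x₂ h₁ h₀ (by linarith) e₁ e₂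
    obtain ⟨y₂, _, _, f₂⟩ := rolle 1 (by norm_num) x₂ x₃ h₂ (by linarith) (by linarith) e₂ e₃
    obtain ⟨y₃, _, _, f₃⟩ := rolle 1 (by norm_num) x₃ x₄ h₃ (by linarith) h₅ e₃ e₄
    obtain ⟨z₁, _, _, g₁⟩ :=
      rolle 2 (by norm_num) y₁ y₂ (by linarith) (by linarith) (by linarith) f₁ f₂
    obtain ⟨z₂, _, _, g₂⟩ :=
      rolle 2 (by norm_num) y₂ y₃ (by linarith) (by linarith) (by linarith) f₂ f₃
    obtain ⟨ξ, _, _, hξ⟩ :=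
      rolle 3 (by norm_num) z₁ z₂ (by linarith) (by linarith) (by linarith) g₁ g₂
    have hξ4 := h4 ξ ⟨by linarith, by linarith⟩
    have hq4 : (derivative^[4] q).eval ξ = 24 * c := by
      rw [hq, iterate_map_add, iterate_derivative_eq_zero (by omega : p.natDegree < 4)]
      simp only [hw, Function.iterate_succ_apply, Function.iterate_zero_apply, derivative_mul,
        derivative_C, derivative_pow, derivative_sub, derivative_X, derivative_add,
        derivative_one, derivative_zero, eval_add, eval_mul, eval_sub,
        eval_pow, eval_X, eval_C, eval_zero, eval_one]
      simp
      ring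
    simp only [hφ] at hξ
    rw [show 3 + 1 = 4 from rfl, hq4] at hξ
    linarith
  have hφ0 (x : ℝ) : φ 0 x = h x - p.eval x - c * w.eval x := by
    simp [hφ, hq]; ring
  have zℓ : φ 0 ℓ = 0 := by rw [hφ0, hint.eval_lower]; simp [hw]
  have za : φ 0 a = 0 := by rw [hφ0, hint.eval_touch]; simp [hw]
  have zu : φ 0 u = 0 := by rw [hφ0, hint.eval_upper]; simp [hw]
  have zt : φ 0 t = 0 := by rw [hφ0, hc]; field_simp [hwt.ne]; ring
  have za' : φ 1 a = 0 := by
    simp only [hφ, iteratedDerivWithin_one, Function.iterate_one, hq, derivative_add, eval_add,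
      hint.deriv_touch]
    simp [hw, derivative_pow]
  -- The four simple zeros ℓ, a, t, u of φ give three zeros of φ′; the double zero a is the fourth.
  rcases hta.lt_or_gt with hlt | hgt
  · obtain ⟨x₁, _, _, e₁⟩ := rolle 0 (by norm_num) ℓ t htℓ hℓ1 (by linarith) zℓ zt
    obtain ⟨x₂, _, _, e₂⟩ := rolle 0 (by norm_num) t a hlt (by linarith) (by linarith) zt za
    obtain ⟨x₄, _, _, e₄⟩ := rolle 0 (by norm_num) a u hu (by linarith) hu1 za zu
    exact key x₁ x₂ a x₄ (by linarith) (by linarith) (by linarith) (by linarith) (by linarith)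
      e₁ e₂ za' e₄
  · obtain ⟨x₁, _, _, e₁⟩ := rolle 0 (by norm_num) ℓ a hℓ hℓ1 (by linarith) zℓ za
    obtain ⟨x₃, _, _, e₃⟩ := rolle 0 (by norm_num) a t hgt (by linarith) (by linarith) za zt
    obtain ⟨x₄, _, _, e₄⟩ := rolle 0 (by norm_num) t u htu (by linarith) hu1 zt zu
    exact key x₁ a x₃ x₄ (by linarith) (by linarith) (by linarith) (by linarith) (by linarith)
      e₁ za' e₃ e₄

/-! ### The linear programming value as a quadrature -/

/-- At the touching point, the linear programming value depends only on the values at the nodes. -/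
theorem lpValue_eq_cubicBound {n : ℕ} (hn : 2 ≤ n) (N : ℕ) (g : Fin 4 → ℝ) {ℓ a u : ℝ}
    (hℓ : ℓ < a) (hu : a < u) (ha : a * touchDen n N ℓ u = touchNum n N ℓ u) :
    lpValue n N g = cubicBound n N (fun t => (gegenbauerCubic n g).eval t) ℓ u a := by
  have h1 : (n : ℝ) - 1 ≠ 0 := by
    have : (2 : ℝ) ≤ n := by exact_mod_cast hn
    linarith
  have h0 : (n : ℝ) ≠ 0 := by positivity
  have e1 : ℓ - a ≠ 0 := by linarith
  have e2 : u - ℓ ≠ 0 := by linarith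
  have e3 : u - a ≠ 0 := by linarith
  obtain ⟨c, hc0, hc⟩ : ∃ c : Fin 4 → ℝ, g 0 = c 0 + c 2 / n ∧ ∀ t,
      (gegenbauerCubic n g).eval t = c 0 + c 1 * t + c 2 * t ^ 2 + c 3 * t ^ 3 := by
    refine ⟨![g 0 - g 2 / (n - 1), g 1 - 3 * g 3 / (n - 1), n * g 2 / (n - 1),
      (n + 2) * g 3 / (n - 1)], ?_, fun t => ?_⟩
    · simp; field_simp; ring
    · rw [gegenbauerCubic_eq hn]; simp
  simp only [lpValue, cubicBound, hc, hc0]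
  simp only [touchDen, touchNum] at ha
  rw [show c 0 + c 1 * ℓ + c 2 * ℓ ^ 2 + c 3 * ℓ ^ 3 - (c 0 + c 1 * a + c 2 * a ^ 2 + c 3 * a ^ 3)
      = (ℓ - a) * (c 1 + c 2 * (ℓ + a) + c 3 * (ℓ ^ 2 + ℓ * a + a ^ 2)) by ring,
    show c 0 + c 1 * u + c 2 * u ^ 2 + c 3 * u ^ 3 - (c 0 + c 1 * a + c 2 * a ^ 2 + c 3 * a ^ 3)
      = (u - a) * (c 1 + c 2 * (u + a) + c 3 * (u ^ 2 + u * a + a ^ 2)) by ring]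
  -- The bracket is g′(a)/((a−ℓ)(a−u)) expressed by divided differences, so this is the derivative
  -- term of the Hermite formula times aB − A.
  linear_combination (norm := skip)
    (N / n * (c 3 - (c 1 + c 2 * (ℓ + a) + c 3 * (ℓ ^ 2 + ℓ * a + a ^ 2)) / ((ℓ - a) * (ℓ - u))
      - (c 1 + c 2 * (u + a) + c 3 * (u ^ 2 + u * a + a ^ 2)) / ((u - a) * (u - ℓ)))) * ha
  rw [show ℓ - u = -(u - ℓ) by ring]
  field_simp
  ring

/-! ### Linear programming on designs and the touching point -/

open Classical in
theorem sphericalEnergy_eq_sum_erase {n : ℕ} (h : ℝ → ℝ)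
    (C : Finset (EuclideanSpace ℝ (Fin n))) :
    sphericalEnergy h C = ∑ y ∈ C, ∑ x ∈ C.erase y, h (inner ℝ x y) := by
  rw [sphericalEnergy, Finset.sum_sigma']
  refine Finset.sum_bij' (fun p _ => ⟨p.2, p.1⟩) (fun q _ => (q.2, q.1)) ?_ ?_ ?_ ?_ ?_ <;>
    simp +contextual

open Classical in
/-- The sum of a cubic over the inner products with a fixed point of a `3`-design. -/
theorem IsSphericalDesign.sum_erase_cubic {n τ : ℕ} {C : Finset (EuclideanSpace ℝ (Fin n))}
    (hC : IsSphericalDesign n τ C) (hτ : 3 ≤ τ) (hn : 2 ≤ n) {y : EuclideanSpace ℝ (Fin n)}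
    (hy : y ∈ C) (c₀ c₁ c₂ c₃ : ℝ) :
    ∑ x ∈ C.erase y, (c₀ + c₁ * inner ℝ x y + c₂ * inner ℝ x y ^ 2 + c₃ * inner ℝ x y ^ 3)
      = (c₀ + c₂ / n) * C.card - (c₀ + c₁ + c₂ + c₃) := by
  have hn0 : 0 < n := by omega
  have hyn := hC.norm_eq_one y hy
  have h1 := hC.sum_inner_pow y (k := 1) (by omega)
  have h2 := hC.sum_inner_pow y (k := 2) (by omega)
  have h3 := hC.sum_inner_pow y (k := 3) (by omega)
  rw [sphereMoment_of_odd n (by decide)] at h1 h3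
  rw [sphereMoment_two hn0, hyn] at h2
  simp only [pow_one] at h1
  have := Finset.sum_erase_add C (fun x => c₀ + c₁ * inner ℝ x y + c₂ * inner ℝ x y ^ 2
    + c₃ * inner ℝ x y ^ 3) hy
  simp only [real_inner_self_eq_norm_sq, hyn, Finset.sum_add_distrib, ← Finset.mul_sum,
    h1, h2, h3, Finset.sum_const, nsmul_eq_mul] at this ⊢
  linear_combination this

open Classical in
theorem IsSphericalDesign.sum_erase_gegenbauerCubic {n τ : ℕ}
    {C : Finset (EuclideanSpace ℝ (Fin n))} (hC : IsSphericalDesign n τ C) (hτ : 3 ≤ τ)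
    (hn : 2 ≤ n) {y : EuclideanSpace ℝ (Fin n)} (hy : y ∈ C) (g : Fin 4 → ℝ) :
    ∑ x ∈ C.erase y, (gegenbauerCubic n g).eval (inner ℝ x y)
      = g 0 * C.card - (gegenbauerCubic n g).eval 1 := by
  have h1 : (n : ℝ) - 1 ≠ 0 := by
    have : (2 : ℝ) ≤ n := by exact_mod_cast hn
    linarith
  have h0 : (n : ℝ) ≠ 0 := by positivity
  have := hC.sum_erase_cubic hτ hn hy (g 0 - g 2 / (n - 1)) (g 1 - 3 * g 3 / (n - 1))
    (n * g 2 / (n - 1)) ((n + 2) * g 3 / (n - 1))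
  simp only [gegenbauerCubic_eq hn, eval_add, eval_mul, eval_C, eval_X, eval_pow]
  rw [this]
  field_simp
  ring

/-- The linear programming bound given by a cubic lying above the potential. -/
theorem sphericalEnergy_le_lpValue {n N τ : ℕ} {C : Finset (EuclideanSpace ℝ (Fin n))}
    (hC : C ∈ sphericalDesigns n N τ) (hτ : 3 ≤ τ) (hn : 2 ≤ n) {ℓ u : ℝ}
    (hb : IsInnerProductBounds n N τ ℓ u) {h : ℝ → ℝ} (g : Fin 4 → ℝ)
    (hg : ∀ t ∈ Set.Icc ℓ u, h t ≤ (gegenbauerCubic n g).eval t) :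
    sphericalEnergy h C ≤ lpValue n N g := by
  classical
  rw [sphericalEnergy_eq_sum_erase]
  calc _ ≤ ∑ y ∈ C, ∑ x ∈ C.erase y, (gegenbauerCubic n g).eval (inner ℝ x y) := by
        refine Finset.sum_le_sum fun y hy => Finset.sum_le_sum fun x hx => hg _ ?_
        exact hb.bounds C hC x (Finset.mem_of_mem_erase hx) y hy (Finset.ne_of_mem_erase hx)
    _ = ∑ y ∈ C, (g 0 * C.card - (gegenbauerCubic n g).eval 1) :=
        Finset.sum_congr rfl fun y hy => hC.1.sum_erase_gegenbauerCubic hτ hn hy g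
    _ = _ := by rw [Finset.sum_const, nsmul_eq_mul, hC.2, lpValue]

/-- Otherwise all inner products with a fixed point equal ℓ. The first and third moments then give
(N−1)ℓ = (N−1)ℓ³ = −1, so ℓ = ±1 and N is 0 or 2. -/
theorem lower_lt_upper {n N τ : ℕ} (hne : (sphericalDesigns n N τ).Nonempty) (hτ : 3 ≤ τ)
    (hn : 2 ≤ n) (hN : 3 ≤ N) {ℓ u : ℝ} (hb : IsInnerProductBounds n N τ ℓ u) : ℓ < u := by
  classical
  obtain ⟨C, hC⟩ := hne
  have hN' : (3 : ℝ) ≤ N := by exact_mod_cast hN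
  obtain ⟨y, hy⟩ : C.Nonempty := Finset.card_pos.1 (by rw [hC.2]; omega)
  by_contra! hle
  have hconst : ∀ x ∈ C.erase y, inner ℝ x y = ℓ := fun x hx => by
    have := hb.bounds C hC x (Finset.mem_of_mem_erase hx) y hy (Finset.ne_of_mem_erase hx)
    linarith
  have hc : ((C.erase y).card : ℝ) = N - 1 := by
    rw [Finset.card_erase_of_mem hy, hC.2, Nat.cast_sub (by omega)]; simp
  have h1 := hC.1.sum_erase_cubic hτ hn hy 0 1 0 0
  have h3 := hC.1.sum_erase_cubic hτ hn hy 0 0 0 1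
  rw [Finset.sum_congr rfl fun x hx => by rw [hconst x hx], Finset.sum_const, nsmul_eq_mul, hc]
    at h1 h3
  norm_num at h1 h3
  have h2 : ℓ ^ 2 = 1 := by linear_combination -h3 + ℓ ^ 2 * h1
  rcases mul_self_eq_one_iff.1 ((sq ℓ).symm.trans h2) with rfl | rfl <;> linarith

/-- Fix y in the design and give each s = ⟨x,y⟩ the weight (s−ℓ)(u−s) ≥ 0. The weights sum to B/n
and have first moment A/n, so a₀ = A/B is a weighted mean. If B = 0, all weights vanish and A = 0
too. -/
theorem touchPoint_spec {n N τ : ℕ} (hne : (sphericalDesigns n N τ).Nonempty) (hτ : 3 ≤ τ)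
    (hn : 2 ≤ n) (hN : 0 < N) {ℓ u : ℝ} (hb : IsInnerProductBounds n N τ ℓ u) :
    0 ≤ touchDen n N ℓ u ∧ (touchDen n N ℓ u = 0 → touchNum n N ℓ u = 0) ∧
      (touchDen n N ℓ u ≠ 0 → touchPoint n N ℓ u ∈ Set.Ioo ℓ u) := by
  classical
  obtain ⟨C, hC⟩ := hne
  obtain ⟨y, hy⟩ : C.Nonempty := Finset.card_pos.1 (by rw [hC.2]; omega)
  have hn0 : (0 : ℝ) < n := by positivity
  have hmem : ∀ x ∈ C.erase y, 0 ≤ inner ℝ x y - ℓ ∧ 0 ≤ u - inner ℝ x y := fun x hx => by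
    have := hb.bounds C hC x (Finset.mem_of_mem_erase hx) y hy (Finset.ne_of_mem_erase hx)
    constructor <;> linarith
  have hden : ∑ x ∈ C.erase y, (inner ℝ x y - ℓ) * (u - inner ℝ x y)
      = touchDen n N ℓ u / n := by
    have := hC.1.sum_erase_cubic hτ hn hy (-ℓ * u) (ℓ + u) (-1) 0
    rw [hC.2] at this
    rw [touchDen]
    calc _ = _ := Finset.sum_congr rfl fun x _ => by ring
      _ = _ := this
      _ = _ := by field_simp; ring
  have hnum : ∑ x ∈ C.erase y, inner ℝ x y * ((inner ℝ x y - ℓ) * (u - inner ℝ x y))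
      = touchNum n N ℓ u / n := by
    have := hC.1.sum_erase_cubic hτ hn hy 0 (-ℓ * u) (ℓ + u) (-1)
    rw [hC.2] at this
    rw [touchNum]
    calc _ = _ := Finset.sum_congr rfl fun x _ => by ring
      _ = _ := this
      _ = _ := by field_simp; ring
  have hnn : ∀ x ∈ C.erase y, 0 ≤ (inner ℝ x y - ℓ) * (u - inner ℝ x y) := fun x hx =>
    mul_nonneg (hmem x hx).1 (hmem x hx).2
  have hB : 0 ≤ touchDen n N ℓ u := by
    have := Finset.sum_nonneg hnn
    rw [hden] at this
    exact nonneg_of_mul_nonneg_left (by simpa [div_eq_mul_inv] using this) (inv_pos.2 hn0)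
  refine ⟨hB, fun h0 => ?_, fun h0 => ?_⟩
  · rw [h0, zero_div, Finset.sum_eq_zero_iff_of_nonneg hnn] at hden
    rw [Finset.sum_eq_zero fun x hx => by rw [hden x hx, mul_zero]] at hnum
    have := hnum.symm
    rw [div_eq_zero_iff] at this
    exact this.resolve_right hn0.ne'
  · have hB' : 0 < touchDen n N ℓ u := lt_of_le_of_ne hB (Ne.symm h0)
    obtain ⟨x₀, hx₀, hpos⟩ : ∃ x ∈ C.erase y, 0 < (inner ℝ x y - ℓ) * (u - inner ℝ x y) := by
      by_contra! hle
      have := Finset.sum_nonpos hle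
      rw [hden] at this
      exact absurd this (not_le.2 (div_pos hB' hn0))
    have hx₁ : 0 < inner ℝ x₀ y - ℓ :=
      lt_of_le_of_ne (hmem x₀ hx₀).1 fun h => by rw [← h] at hpos; simp at hpos
    have hx₂ : 0 < u - inner ℝ x₀ y :=
      lt_of_le_of_ne (hmem x₀ hx₀).2 fun h => by rw [← h] at hpos; simp at hpos
    have lo : 0 < ∑ x ∈ C.erase y,
        (inner ℝ x y - ℓ) * ((inner ℝ x y - ℓ) * (u - inner ℝ x y)) :=
      Finset.sum_pos' (fun x hx => mul_nonneg (hmem x hx).1 (hnn x hx)) ⟨x₀, hx₀, by positivity⟩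
    have hi : 0 < ∑ x ∈ C.erase y,
        (u - inner ℝ x y) * ((inner ℝ x y - ℓ) * (u - inner ℝ x y)) :=
      Finset.sum_pos' (fun x hx => mul_nonneg (hmem x hx).2 (hnn x hx)) ⟨x₀, hx₀, by positivity⟩
    rw [Finset.sum_congr rfl fun x _ => sub_mul _ _ _, Finset.sum_sub_distrib, ← Finset.mul_sum,
      hden, hnum, sub_pos, ← mul_div_assoc, div_lt_div_iff_of_pos_right hn0] at lo hi
    exact ⟨(lt_div_iff₀ hB').2 lo, (div_lt_iff₀ hB').2 hi⟩

theorem exists_lpValue_eq_cubicBound {n : ℕ} (hn : 2 ≤ n) (N : ℕ) (h : ℝ → ℝ) {ℓ a u : ℝ}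
    (hℓ : ℓ < a) (hu : a < u) (ha : a * touchDen n N ℓ u = touchNum n N ℓ u) :
    ∃ g : Fin 4 → ℝ, Interpolates h ℓ a u (gegenbauerCubic n g) ∧
      lpValue n N g = cubicBound n N h ℓ u a := by
  obtain ⟨g, hg⟩ := exists_interpolates hn h hℓ hu
  refine ⟨g, hg, ?_⟩
  rw [lpValue_eq_cubicBound hn N g hℓ hu ha]
  simp only [cubicBound, hg.eval_lower, hg.eval_touch, hg.eval_upper]

/-- The condition aB = A, rather than a = A/B, also covers B = A = 0, where every a in (ℓ,u)
qualifies. -/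
theorem maxDesignEnergy_le_cubicBound {n N τ : ℕ} (hτ : 3 ≤ τ) (hn : 2 ≤ n) {h : ℝ → ℝ}
    (hC4 : ContDiffOn ℝ 4 h (Set.Icc (-1) 1))
    (h4 : ∀ t ∈ Set.Icc (-1 : ℝ) 1, 0 ≤ iteratedDerivWithin 4 h (Set.Icc (-1) 1) t)
    {ℓ a u : ℝ} (hb : IsInnerProductBounds n N τ ℓ u) (hℓ : ℓ < a) (hu : a < u)
    (ha : a * touchDen n N ℓ u = touchNum n N ℓ u) :
    maxDesignEnergy n N τ h ≤ ((cubicBound n N h ℓ u a : ℝ) : EReal) := by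
  obtain ⟨g, hg, hgF⟩ := exists_lpValue_eq_cubicBound hn N h hℓ hu ha
  refine iSup₂_le fun C hC => EReal.coe_le_coe ?_
  rw [← hgF]
  exact sphericalEnergy_le_lpValue hC hτ hn hb g fun t ht =>
    le_eval_of_interpolates hC4 h4 hb.neg_one_le hb.le_one hℓ hu
      (natDegree_gegenbauerCubic_le hn g) hg ht

/-- Among all touching points, `a₀` gives the smallest linear programming value. -/
theorem cubicBound_touchPoint_le_lpValue {n : ℕ} (N : ℕ) (hn : 2 ≤ n) {h : ℝ → ℝ}
    (hC4 : ContDiffOn ℝ 4 h (Set.Icc (-1) 1))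
    (h4 : ∀ t ∈ Set.Icc (-1 : ℝ) 1, 0 ≤ iteratedDerivWithin 4 h (Set.Icc (-1) 1) t)
    {ℓ u : ℝ} (hℓ1 : -1 ≤ ℓ) (hu1 : u ≤ 1) (hB : 0 < touchDen n N ℓ u)
    (h0 : touchPoint n N ℓ u ∈ Set.Ioo ℓ u) {a : ℝ} (ha : a ∈ Set.Ioo ℓ u) {g : Fin 4 → ℝ}
    (hg : Interpolates h ℓ a u (gegenbauerCubic n g)) :
    cubicBound n N h ℓ u (touchPoint n N ℓ u) ≤ lpValue n N g := by
  have hq : touchPoint n N ℓ u * touchDen n N ℓ u = touchNum n N ℓ u :=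
    div_mul_cancel₀ _ hB.ne'
  have hle := le_eval_of_interpolates hC4 h4 hℓ1 hu1 ha.1 ha.2
    (natDegree_gegenbauerCubic_le hn g) hg (Set.Ioo_subset_Icc_self h0)
  rw [lpValue_eq_cubicBound hn N g h0.1 h0.2 hq]
  generalize touchPoint n N ℓ u = a₀ at *
  simp only [cubicBound, hg.eval_lower, hg.eval_upper]
  set e := (gegenbauerCubic n g).eval a₀
  have hn0 : (0 : ℝ) < n := by positivity
  have e1 : a₀ - ℓ ≠ 0 := by linarith [h0.1]
  have e1' : ℓ - a₀ ≠ 0 := by linarith [h0.1]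
  have e2 : u - a₀ ≠ 0 := by linarith [h0.2]
  have e3 : u - ℓ ≠ 0 := by linarith [h0.1, h0.2]
  -- The second factor is the quadrature weight at a₀. `cubicBound` writes it in Hermite form, which
  -- agrees with this one modulo a₀B − A; hence the multiple of `hq` below.
  have hw : 0 ≤ (e - h a₀) * (N * touchDen n N ℓ u / (n * ((a₀ - ℓ) * (u - a₀)))) := by
    refine mul_nonneg (by linarith) (div_nonneg (by positivity) ?_)
    exact mul_nonneg hn0.le (mul_nonneg (by linarith [h0.1]) (by linarith [h0.2]))
  refine sub_nonneg.1 (hw.trans_eq ?_)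
  simp only [touchDen, touchNum] at hq ⊢
  linear_combination (norm := skip) (e - h a₀) * N / (n * ((a₀ - ℓ) * (u - a₀))) *
    (-(u - a₀) / ((ℓ - a₀) * (ℓ - u)) - (ℓ - a₀) / ((u - a₀) * (u - ℓ))) * hq
  rw [show ℓ - u = -(u - ℓ) by ring, show a₀ - ℓ = -(ℓ - a₀) by ring]
  field_simp
  ring

/-! ### Admissible bounds for the inner products -/

theorem isInnerProductBounds_three (n N : ℕ) :
    IsInnerProductBounds n N 3 (-1) (maxInnerProduct n N 3) := by
  have hcs : ∀ C ∈ sphericalDesigns n N 3, ∀ x ∈ C, ∀ y ∈ C, |inner ℝ x y| ≤ 1 :=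
    fun C hC x hx y hy => by
      simpa [hC.1.norm_eq_one x hx, hC.1.norm_eq_one y hy] using abs_real_inner_le_norm x y
  refine ⟨le_rfl, Real.sSup_le ?_ zero_le_one, fun C hC x hx y hy hxy => ⟨?_, ?_⟩⟩
  · rintro t ⟨C, hC, x, hx, y, hy, -, rfl⟩
    exact (abs_le.1 (hcs C hC x hx y hy)).2
  · exact (abs_le.1 (hcs C hC x hx y hy)).1
  · refine le_csSup ⟨1, ?_⟩ ⟨C, hC, x, hx, y, hy, hxy, rfl⟩
    rintro t ⟨C, hC, x, hx, y, hy, -, rfl⟩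
    exact (abs_le.1 (hcs C hC x hx y hy)).2

/-- The sum of the square of a quadratic in the inner products with `v` over a `4`-design. -/
theorem IsSphericalDesign.sum_sq_quadratic {n τ : ℕ} {C : Finset (EuclideanSpace ℝ (Fin n))}
    (hC : IsSphericalDesign n τ C) (hτ : 4 ≤ τ) (hn : 0 < n) (v : EuclideanSpace ℝ (Fin n))
    (b₀ b₁ b₂ : ℝ) :
    ∑ z ∈ C, (b₀ + b₁ * inner ℝ z v + b₂ * inner ℝ z v ^ 2) ^ 2
      = C.card * (b₀ ^ 2 + (b₁ ^ 2 + 2 * b₀ * b₂) * (‖v‖ ^ 2 / n)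
        + b₂ ^ 2 * (3 * (‖v‖ ^ 2) ^ 2 / (n * (n + 2)))) := by
  have h1 := hC.sum_inner_pow v (k := 1) (by omega)
  have h2 := hC.sum_inner_pow v (k := 2) (by omega)
  have h3 := hC.sum_inner_pow v (k := 3) (by omega)
  have h4 := hC.sum_inner_pow v (k := 4) (by omega)
  rw [sphereMoment_of_odd n (by decide)] at h1 h3
  rw [sphereMoment_two hn] at h2
  rw [sphereMoment_four hn] at h4
  have (z : EuclideanSpace ℝ (Fin n)) : (b₀ + b₁ * inner ℝ z v + b₂ * inner ℝ z v ^ 2) ^ 2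
      = b₀ ^ 2 + 2 * b₀ * b₁ * inner ℝ z v ^ 1 + (b₁ ^ 2 + 2 * b₀ * b₂) * inner ℝ z v ^ 2
        + 2 * b₁ * b₂ * inner ℝ z v ^ 3 + b₂ ^ 2 * inner ℝ z v ^ 4 := by ring
  simp only [this, Finset.sum_add_distrib, ← Finset.mul_sum, h1, h2, h3, h4, Finset.sum_const,
    nsmul_eq_mul]
  ring

theorem add_le_sum_of_ne {α : Type*} {s : Finset α} {f : α → ℝ} (hf : ∀ z ∈ s, 0 ≤ f z)
    {x y : α} (hx : x ∈ s) (hy : y ∈ s) (hxy : x ≠ y) : f x + f y ≤ ∑ z ∈ s, f z := by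
  classical
  rw [← Finset.sum_pair hxy]
  exact Finset.sum_le_sum_of_subset_of_nonneg (by simp [Finset.insert_subset_iff, hx, hy])
    fun z hz _ => hf z hz

theorem lowerFour_le_inner {n N : ℕ} (hn : 2 ≤ n) (hN : 3 ≤ N)
    {C : Finset (EuclideanSpace ℝ (Fin n))} (hC : C ∈ sphericalDesigns n N 4)
    {x y : EuclideanSpace ℝ (Fin n)} (hx : x ∈ C) (hy : y ∈ C) (hxy : x ≠ y) :
    lowerFour n N ≤ inner ℝ x y := by
  have hn0 : (0 : ℝ) < n := by positivity
  have hN0 : (3 : ℝ) ≤ N := by exact_mod_cast hN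
  have hxn := hC.1.norm_eq_one x hx
  have hyn := hC.1.norm_eq_one y hy
  set t := inner ℝ x y with ht
  set σ := (1 - t) / 2 with hσ
  have hnorm : ‖x - y‖ ^ 2 = 4 * σ := by
    rw [norm_sub_sq_real, hxn, hyn, hσ, ht]; ring
  have hσ0 : 0 < σ := by
    have : 0 < ‖x - y‖ := norm_pos_iff.2 (sub_ne_zero.2 hxy)
    nlinarith
  have hxv : inner ℝ x (x - y) = 2 * σ := by
    rw [inner_sub_right, real_inner_self_eq_norm_sq, hxn, hσ, ht]; ring
  have hyv : inner ℝ y (x - y) = -(2 * σ) := by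
    rw [inner_sub_right, real_inner_self_eq_norm_sq, hyn, hσ, ht, real_inner_comm]; ring
  have key (γ : ℝ) : 2 * (σ - γ) ^ 2 ≤ N * (γ ^ 2 - 2 * γ / n + 3 / (n * (n + 2))) := by
    have h1 := hC.1.sum_sq_quadratic le_rfl (by omega) (x - y) (-(4 * σ * γ)) 0 1
    have h2 := add_le_sum_of_ne (f := fun z => (-(4 * σ * γ) + 0 * inner ℝ z (x - y)
      + 1 * inner ℝ z (x - y) ^ 2) ^ 2) (fun z _ => sq_nonneg _) hx hy hxy
    rw [h1, hC.2] at h2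
    simp only [hxv, hyv, hnorm] at h2
    refine le_of_mul_le_mul_left ?_ (show 0 < 16 * σ ^ 2 by positivity)
    calc _ = _ := by ring
      _ ≤ _ := h2
      _ = _ := by field_simp; ring
  have hN2 : (N : ℝ) - 2 ≠ 0 := by linarith
  have hsq : (n * σ - 1) ^ 2 ≤ ((n : ℝ) - 1) * ((N : ℝ) - 2) / ((n : ℝ) + 2) := by
    -- This γ minimizes the right side of `key` minus its left side, a quadratic in γ with leading
    -- coefficient N − 2.
    have h1 := key ((N / n - 2 * σ) / (N - 2))
    have h2 : ((n : ℝ) - 1) * ((N : ℝ) - 2) / ((n : ℝ) + 2) - (n * σ - 1) ^ 2 =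
      n ^ 2 * (N - 2) / (2 * N) * (N * (((N / n - 2 * σ) / (N - 2)) ^ 2
        - 2 * ((N / n - 2 * σ) / (N - 2)) / n + 3 / (n * (n + 2)))
        - 2 * (σ - (N / n - 2 * σ) / (N - 2)) ^ 2) := by
      field_simp
      ring
    rw [← sub_nonneg, h2]
    exact mul_nonneg (div_nonneg (mul_nonneg (by positivity) (by linarith)) (by positivity))
      (sub_nonneg.2 h1)
  have := Real.le_sqrt_of_sq_le hsq
  rw [lowerFour, show t = 1 - 2 / n * (n * σ) by rw [hσ]; field_simp; ring]
  gcongr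
  linarith

theorem inner_le_upperFour {n N : ℕ} (hn : 2 ≤ n)
    {C : Finset (EuclideanSpace ℝ (Fin n))} (hC : C ∈ sphericalDesigns n N 4)
    {x y : EuclideanSpace ℝ (Fin n)} (hx : x ∈ C) (hy : y ∈ C) (hxy : x ≠ y) :
    inner ℝ x y ≤ upperFour n N := by
  have hn2 : (2 : ℝ) ≤ n := by exact_mod_cast hn
  have hn0 : (0 : ℝ) < n := by positivity
  have hxn := hC.1.norm_eq_one x hx
  have hyn := hC.1.norm_eq_one y hy
  set t := inner ℝ x y with ht
  set σ := (1 + t) / 2 with hσ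
  have hnorm : ‖x + y‖ ^ 2 = 4 * σ := by
    rw [norm_add_sq_real, hxn, hyn, hσ, ht]; ring
  have htσ : t = 2 * (n * (n + 2) * σ) / (n * (n + 2)) - 1 := by rw [hσ]; field_simp; ring
  have goal_of {z : ℝ} (hz : n * (n + 2) * σ - 3 ≤ z)
      (hz' : z ≤ √(((n : ℝ) - 1) * (((n : ℝ) + 2) * (N : ℝ) - 3 * ((n : ℝ) + 3)))) :
      t ≤ upperFour n N := by
    rw [htσ, upperFour]
    gcongr
    linarith
  rcases (show 0 ≤ σ by nlinarith [sq_nonneg ‖x + y‖]).eq_or_lt with hσ0 | hσ0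
  · exact goal_of (z := 0) (by rw [← hσ0]; norm_num) (Real.sqrt_nonneg _)
  have hxv : inner ℝ x (x + y) = 2 * σ := by
    rw [inner_add_right, real_inner_self_eq_norm_sq, hxn, hσ, ht]; ring
  have hyv : inner ℝ y (x + y) = 2 * σ := by
    rw [inner_add_right, real_inner_self_eq_norm_sq, hyn, hσ, ht, real_inner_comm]; ring
  have hn1 : (0 : ℝ) < n - 1 := by linarith
  -- The quadratic used below is the reproducing kernel at 2σ = ⟨x,v⟩ = ⟨y,v⟩ in the space of
  -- quadratics in ⟨z,v⟩, v = x + y, under the spherical mean. So K is both its value at x and y and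
  -- the mean of its square, and 2K² ≤ NK.
  set K := 1 + n * σ + (n + 2) * (n * σ - 1) ^ 2 / (2 * (n - 1)) with hK
  have hK0 : 0 < K := by positivity
  set β := ((n : ℝ) + 2) * (n * σ - 1) / (2 * (n - 1)) with hβ
  have hKN : 2 * K ≤ N := by
    have h1 := hC.1.sum_sq_quadratic le_rfl (by omega) (x + y) (1 - β) (n / 2) (β * n / (4 * σ))
    have h2 := add_le_sum_of_ne (f := fun z => (1 - β + n / 2 * inner ℝ z (x + y)
      + β * n / (4 * σ) * inner ℝ z (x + y) ^ 2) ^ 2) (fun z _ => sq_nonneg _) hx hy hxy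
    rw [h1, hC.2] at h2
    simp only [hxv, hyv, hnorm] at h2
    have e1 : 1 - β + n / 2 * (2 * σ) + β * n / (4 * σ) * (2 * σ) ^ 2 = K := by
      rw [hK, hβ]; field_simp; ring
    have e2 : (1 - β) ^ 2 + (((n : ℝ) / 2) ^ 2 + 2 * (1 - β) * (β * n / (4 * σ))) * (4 * σ / n)
        + (β * n / (4 * σ)) ^ 2 * (3 * (4 * σ) ^ 2 / (n * (n + 2))) = K := by
      rw [hK, hβ]; field_simp; ring
    rw [e1, e2] at h2
    refine le_of_mul_le_mul_right ?_ hK0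
    linarith
  refine goal_of le_rfl (Real.le_sqrt_of_sq_le ?_)
  have h3 : ((n : ℝ) - 1) * (((n : ℝ) + 2) * (N : ℝ) - 3 * ((n : ℝ) + 3))
      - (n * (n + 2) * σ - 3) ^ 2 = (n - 1) * (n + 2) * (N - 2 * K) := by
    rw [hK]; field_simp; ring
  rw [← sub_nonneg, h3]
  exact mul_nonneg (by positivity) (by linarith)

theorem isInnerProductBounds_four {n N : ℕ} (hn : 2 ≤ n) (hN : 3 ≤ N) (hN' : N < n ^ 2 + n) :
    IsInnerProductBounds n N 4 (lowerFour n N) (upperFour n N) := by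
  have hn2 : (2 : ℝ) ≤ n := by exact_mod_cast hn
  have hN2 : (N : ℝ) < (n : ℝ) ^ 2 + n := by exact_mod_cast hN'
  refine ⟨?_, ?_, fun C hC x hx y hy hxy =>
    ⟨lowerFour_le_inner hn hN hC hx hy hxy, inner_le_upperFour hn hC hx hy hxy⟩⟩
  · have : √(((n : ℝ) - 1) * ((N : ℝ) - 2) / ((n : ℝ) + 2)) ≤ n - 1 := by
      refine Real.sqrt_le_iff.2 ⟨by linarith, ?_⟩
      rw [div_le_iff₀ (by linarith)]
      nlinarith
    rw [lowerFour]
    have : 2 / (n : ℝ) * (1 + √(((n : ℝ) - 1) * ((N : ℝ) - 2) / ((n : ℝ) + 2)))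
        ≤ 2 / (n : ℝ) * n := by
      gcongr
      linarith
    have : 2 / (n : ℝ) * n = 2 := by field_simp
    linarith
  · have : √(((n : ℝ) - 1) * (((n : ℝ) + 2) * (N : ℝ) - 3 * ((n : ℝ) + 3)))
        ≤ (n + 3) * (n - 1) := by
      refine Real.sqrt_le_iff.2 ⟨mul_nonneg (by linarith) (by linarith), ?_⟩
      rw [show (((n : ℝ) + 3) * (n - 1)) ^ 2 = (n - 1) * ((n + 3) ^ 2 * (n - 1)) by ring]
      refine mul_le_mul_of_nonneg_left ?_ (by linarith)
      nlinarith
    rw [upperFour, sub_le_iff_le_add, div_le_iff₀ (by positivity)]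
    linarith

/-! ### Positivity of B for the explicit 4-design bounds -/

theorem touchDen_pos_of_lt {n N : ℕ} (hN : 0 < N) {ℓ u : ℝ} (hℓ : ℓ ≤ 1) (hu : u ≤ 1)
    (h : 1 < -(n * ℓ) * u) : 0 < touchDen n N ℓ u := by
  have h1 : 0 ≤ (n : ℝ) * (1 - ℓ) * (1 - u) :=
    mul_nonneg (mul_nonneg (by positivity) (by linarith)) (by linarith)
  have h2 : 0 < (N : ℝ) * (-(n * ℓ) * u - 1) := mul_pos (by positivity) (by linarith)
  rw [touchDen]
  linarith

theorem le_neg_mul_lowerFour {n N : ℕ} (hn : 0 < n) {b : ℝ}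
    (hb : b ^ 2 ≤ ((n : ℝ) - 1) * ((N : ℝ) - 2) / ((n : ℝ) + 2)) :
    2 + 2 * b - n ≤ -(n * lowerFour n N) := by
  have := Real.le_sqrt_of_sq_le hb
  rw [lowerFour]
  field_simp
  linarith

theorem le_upperFour {n N : ℕ} (hn : 0 < n) {b : ℝ}
    (hb : b ^ 2 ≤ ((n : ℝ) - 1) * (((n : ℝ) + 2) * (N : ℝ) - 3 * ((n : ℝ) + 3))) :
    2 * (3 + b) / (n * (n + 2)) - 1 ≤ upperFour n N := by
  have := Real.le_sqrt_of_sq_le hb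
  rw [upperFour]
  gcongr

/-- B = n(1−ℓ)(1−u) + N(−nℓu − 1), so −nℓu > 1 suffices. It fails only for (n,N) = (2,5) and (3,9),
where the full expression is estimated. The decimals `b` are rational lower bounds for the square
roots; for n ≥ 5, 0.705 and 0.695 lie just below the limiting ratio 1/√2. -/
theorem touchDen_four_pos {n N : ℕ} (hn : 2 ≤ n) (hN : (n : ℝ) * ((n : ℝ) + 3) / 2 ≤ (N : ℝ))
    (hN' : N < n ^ 2 + n) : 0 < touchDen n N (lowerFour n N) (upperFour n N) := by
  have hn2 : (2 : ℝ) ≤ n := by exact_mod_cast hn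
  have hNpos : 3 ≤ N := by
    have : (3 : ℝ) ≤ N := by nlinarith
    exact_mod_cast this
  have hu1 := (isInnerProductBounds_four hn hNpos hN').le_one
  have hℓ1 : lowerFour n N ≤ 1 := by
    rw [lowerFour]
    have : 0 ≤ 2 / (n : ℝ) * (1 + √(((n : ℝ) - 1) * ((N : ℝ) - 2) / ((n : ℝ) + 2))) := by
      positivity
    linarith
  obtain rfl | rfl | rfl | h5 : n = 2 ∨ n = 3 ∨ n = 4 ∨ 5 ≤ n := by omega
  · have : (5 : ℝ) ≤ N := by norm_num at hN; exact_mod_cast hN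
    obtain rfl : N = 5 := by
      have : 5 ≤ N := by exact_mod_cast this
      omega
    have h1 := le_neg_mul_lowerFour (n := 2) (N := 5) (b := 0.86) (by norm_num) (by norm_num)
    have h2 := le_upperFour (n := 2) (N := 5) (b := 2.2) (by norm_num) (by norm_num)
    rw [touchDen]
    norm_num at h1 h2 ⊢
    nlinarith
  · have : (9 : ℝ) ≤ N := by norm_num at hN; exact_mod_cast hN
    have h9 : 9 ≤ N := by exact_mod_cast this
    obtain rfl | h10 := h9.eq_or_lt
    · have h1 := le_neg_mul_lowerFour (n := 3) (N := 9) (b := 1.67) (by norm_num) (by norm_num)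
      have h2 := le_upperFour (n := 3) (N := 9) (b := 7.3) (by norm_num) (by norm_num)
      rw [touchDen]
      norm_num at h1 h2 ⊢
      nlinarith
    · have h10' : (10 : ℝ) ≤ N := by exact_mod_cast h10
      have h1 := le_neg_mul_lowerFour (n := 3) (N := N) (b := 1.78) (by norm_num)
        (by norm_num; linarith)
      have h2 := le_upperFour (n := 3) (N := N) (b := 8) (by norm_num) (by norm_num; linarith)
      refine touchDen_pos_of_lt (by omega) hℓ1 hu1 ?_
      norm_num at h1 h2 ⊢
      nlinarith
  · have h14 : (14 : ℝ) ≤ N := by norm_num at hN; exact_mod_cast hN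
    have h1 := le_neg_mul_lowerFour (n := 4) (N := N) (b := 2.44) (by norm_num)
      (by norm_num; linarith)
    have h2 := le_upperFour (n := 4) (N := N) (b := 13.7) (by norm_num) (by norm_num; linarith)
    refine touchDen_pos_of_lt (by omega) hℓ1 hu1 ?_
    norm_num at h1 h2 ⊢
    nlinarith
  · have h5' : (5 : ℝ) ≤ n := by exact_mod_cast h5
    have h1 := le_neg_mul_lowerFour (n := n) (N := N) (b := 0.705 * (n - 1)) (by omega) (by
      rw [le_div_iff₀ (by linarith),
        show (0.705 * ((n : ℝ) - 1)) ^ 2 * (n + 2) = (n - 1) * (0.705 ^ 2 * (n - 1) * (n + 2)) by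
          ring]
      refine mul_le_mul_of_nonneg_left ?_ (by linarith)
      nlinarith)
    have h2 := le_upperFour (n := n) (N := N) (b := 0.695 * (n * (n + 2)) - 3) (by omega) (by
      have : ((n : ℝ) - 1) * ((n + 2) * (n * (n + 3) / 2) - 3 * (n + 3))
          ≤ (n - 1) * ((n + 2) * N - 3 * (n + 3)) := by gcongr; linarith
      refine le_trans ?_ this
      have hm : (24 : ℝ) ≤ n * (n + 2) := by nlinarith
      calc _ ≤ ((n : ℝ) * (n + 2) - 3) * (n * (n + 2) - 6) / 2 := by nlinarith
        _ = _ := by ring)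
    have h3 : (0.39 : ℝ) ≤ upperFour n N := by
      refine le_trans (le_of_eq ?_) h2
      field_simp
      ring
    refine touchDen_pos_of_lt (by omega) hℓ1 hu1 ?_
    nlinarith

end

theorem theorem6p5 (n N τ : ℕ) (h : ℝ → ℝ)
    (hC4 : ContDiffOn ℝ 4 h (Set.Icc (-1) 1))
    (h4 : ∀ t ∈ Set.Icc (-1 : ℝ) 1, 0 ≤ iteratedDerivWithin 4 h (Set.Icc (-1) 1) t)
    (hcase : (τ = 3 ∧ 2 * n ≤ N ∧ (N : ℝ) < (n : ℝ) * ((n : ℝ) + 3) / 2) ∨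
      (τ = 4 ∧ (n : ℝ) * ((n : ℝ) + 3) / 2 ≤ (N : ℝ) ∧ N < n ^ 2 + n)) :
    -- the bound, for arbitrary bounds on the inner products
    (∀ ℓ u : ℝ, IsInnerProductBounds n N τ ℓ u →
      (touchDen n N ℓ u ≠ 0 →
        maxDesignEnergy n N τ h ≤ ((cubicBound n N h ℓ u (touchPoint n N ℓ u) : ℝ) : EReal)) ∧
      (touchDen n N ℓ u = 0 → ∀ a ∈ Set.Ioo ℓ u,
        maxDesignEnergy n N τ h ≤ ((cubicBound n N h ℓ u a : ℝ) : EReal)) ∧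
      -- the formula makes sense, is the value of the Hermite interpolant, and is optimal in `a`
      ((sphericalDesigns n N τ).Nonempty →
        ℓ < u ∧ 0 ≤ touchDen n N ℓ u ∧
        (touchDen n N ℓ u ≠ 0 →
          touchPoint n N ℓ u ∈ Set.Ioo ℓ u ∧
          (∃ g : Fin 4 → ℝ, Interpolates h ℓ (touchPoint n N ℓ u) u (gegenbauerCubic n g) ∧
            lpValue n N g = cubicBound n N h ℓ u (touchPoint n N ℓ u)) ∧
          (∀ a ∈ Set.Ioo ℓ u, ∀ g : Fin 4 → ℝ, Interpolates h ℓ a u (gegenbauerCubic n g) →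
            cubicBound n N h ℓ u (touchPoint n N ℓ u) ≤ lpValue n N g)))) ∧
    -- for 3-designs, `-1` and the supremum of the inner products are admissible
    (τ = 3 → IsInnerProductBounds n N 3 (-1) (maxInnerProduct n N 3)) ∧
    -- for 4-designs, explicit admissible bounds on the inner products
    (τ = 4 →
      IsInnerProductBounds n N 4 (lowerFour n N) (upperFour n N) ∧
      0 < touchDen n N (lowerFour n N) (upperFour n N) ∧
      maxDesignEnergy n N 4 h ≤
        ((cubicBound n N h (lowerFour n N) (upperFour n N)
          (touchPoint n N (lowerFour n N) (upperFour n N)) : ℝ) : EReal)) := by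
  -- For n ≤ 1 both ranges of N are empty.
  obtain ⟨hn, hN, hτ⟩ : 2 ≤ n ∧ 3 ≤ N ∧ 3 ≤ τ := by
    rcases hcase with ⟨rfl, h1, h2⟩ | ⟨rfl, h1, h2⟩
    · have h1' : 2 * (n : ℝ) ≤ N := by exact_mod_cast h1
      have hn : 2 ≤ n := by
        by_contra! hlt
        interval_cases n <;> norm_num at h1' h2 <;> linarith
      omega
    · have hn : 2 ≤ n := by
        by_contra! hlt
        interval_cases n
        · omega
        · norm_num at h1 h2
          omega
      have hn2 : (2 : ℝ) ≤ n := by exact_mod_cast hn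
      have : (3 : ℝ) ≤ N := by nlinarith
      exact ⟨hn, by exact_mod_cast this, by norm_num⟩
  have bound : ∀ ℓ u : ℝ, IsInnerProductBounds n N τ ℓ u → touchDen n N ℓ u ≠ 0 →
      maxDesignEnergy n N τ h ≤ ((cubicBound n N h ℓ u (touchPoint n N ℓ u) : ℝ) : EReal) := by
    intro ℓ u hb hB
    rcases (sphericalDesigns n N τ).eq_empty_or_nonempty with he | hne
    · simp [maxDesignEnergy, he]
    · have h0 := (touchPoint_spec hne hτ hn (by omega) hb).2.2 hB
      exact maxDesignEnergy_le_cubicBound hτ hn hC4 h4 hb h0.1 h0.2 (div_mul_cancel₀ _ hB)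
  refine ⟨fun ℓ u hb => ⟨bound ℓ u hb, fun hB a ha => ?_, fun hne => ?_⟩, ?_, ?_⟩
  · rcases (sphericalDesigns n N τ).eq_empty_or_nonempty with he | hne
    · simp [maxDesignEnergy, he]
    · have hA := (touchPoint_spec hne hτ hn (by omega) hb).2.1 hB
      exact maxDesignEnergy_le_cubicBound hτ hn hC4 h4 hb ha.1 ha.2 (by rw [hA, hB, mul_zero])
  · obtain ⟨hB, -, h0⟩ := touchPoint_spec hne hτ hn (by omega) hb
    refine ⟨lower_lt_upper hne hτ hn hN hb, hB, fun hB0 => ⟨h0 hB0, ?_, fun a ha g hg => ?_⟩⟩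
    · exact exists_lpValue_eq_cubicBound hn N h (h0 hB0).1 (h0 hB0).2 (div_mul_cancel₀ _ hB0)
    · exact cubicBound_touchPoint_le_lpValue N hn hC4 h4 hb.neg_one_le hb.le_one
        (lt_of_le_of_ne hB (Ne.symm hB0)) (h0 hB0) ha hg
  · exact fun _ => isInnerProductBounds_three n N
  · rintro rfl
    obtain ⟨hN1, hN2⟩ : (n : ℝ) * ((n : ℝ) + 3) / 2 ≤ (N : ℝ) ∧ N < n ^ 2 + n := by
      rcases hcase with ⟨h34, -⟩ | ⟨-, h1, h2⟩
      · omega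
      · exact ⟨h1, h2⟩
    have hb := isInnerProductBounds_four hn hN hN2
    have hpos := touchDen_four_pos hn hN1 hN2
    exact ⟨hb, hpos, bound _ _ hb hpos.ne'⟩
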